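/- Let $\Bbbk$ be a field. For a topological space $X$ let $\mathrm{H}^*(X)=\bigoplus_{n\ge 0}\mathrm{H}^n(X;\Bbbk)$ be its singular cohomology ring with the cup product, and for a continuous map $f$ let $f^*$ be the induced ring homomorphism. Let $\Delta_X:X\to X\times X$, $\Delta_X(x)=(x,x)$, be the diagonal map. For an ideal $I$ of a ring let $\operatorname{nil}(I)\in\mathbb{N}\cup\{\infty\}$ be the smallest integer $n\ge 0$ with $I^{n+1}=0$, or $\infty$ if there is none. The zero-divisor-cup-length of a topological space $X$ is $$\mathbf{zcl}(X)=\operatorname{nil}\bigl(\ker(\Delta_X^*:\mathrm{H}^*(X\times X)\to \mathrm{H}^*(X))\bigr),$$ and that of a continuous map $f:X\to Y$ is $$\mathbf{zcl}(f)=\operatorname{nil}\bigl(\operatorname{im}((f\times f)^*)\cap\ker(\Delta_X^*)\bigr),$$ where $(f\times f)^*:\mathrm{H}^*(Y\times Y)\to\mathrm{H}^*(X\times X)$ and $\operatorname{im}((f\times f)^*)\cap\ker(\Delta_X^*)$ is regarded as an ideal of the ring $\operatorname{im}((f\times f)^*)$. A categorical invariant of a category $\mathcal{C}$ is a map $\mathbf{I}:\operatorname{Ob}(\mathcal{C})\sqcup\operatorname{Mor}(\mathcal{C})\to\mathbb{N}\cup\{\infty\}$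 such that $\mathbf{I}(\operatorname{id}_X)=\mathbf{I}(X)$ for every object $X$, and $\mathbf{I}(h\circ g\circ f)\le\mathbf{I}(g)$ for all morphisms $X\xrightarrow{f}Y\xrightarrow{g}Z\xrightarrow{h}W$. Lemma. $\mathbf{zcl}$ is a categorical invariant of the category of topological spaces and continuous maps. In particular, $\mathbf{zcl}(\operatorname{id}_X)=\mathbf{zcl}(X)$ for every topological space $X$, and $\mathbf{zcl}(g\circ f)\le\min\{\mathbf{zcl}(f),\mathbf{zcl}(g)\}$ for all continuous maps $f:X\to Y$ and $g:Y\to Z$. -/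

import Mathlib

open CategoryTheory Opposite
open scoped DirectSum

universe u v

noncomputable section

/-! ### Singular cohomology with its cup product -/

namespace SSet

/-- The module of `n`-cochains of a simplicial set `S` with coefficients in `k`: all functions
from the `n`-simplices of `S` to `k`. -/
abbrev Cochain (k : Type v) (S : SSet.{u}) (n : ℕ) : Type (max u v) := S.obj (op (SimplexCategory.mk n)) → k

section Cochains

variable (k : Type v) [CommRing k]

/-- The coboundary operator `(d φ)(σ) = ∑ᵢ (-1)ⁱ φ(∂ᵢ σ)`. -/
def coboundary (S : SSet.{u}) (n : ℕ) : Cochain k S n →ₗ[k] Cochain k S (n + 1) :=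
  ∑ i : Fin (n + 2), (-1 : k) ^ (i : ℕ) • LinearMap.funLeft k k (fun σ => S.δ i σ)

lemma coboundary_apply (S : SSet.{u}) (n : ℕ) (φ : Cochain k S n) (σ : S.obj (op (SimplexCategory.mk (n + 1)))) :
    coboundary k S n φ σ = ∑ i : Fin (n + 2), (-1 : k) ^ (i : ℕ) * φ (S.δ i σ) := by
  simp [coboundary, LinearMap.sum_apply, LinearMap.funLeft_apply]

/-- The module `Zⁿ` of `n`-cocycles. -/
def cocycles (S : SSet.{u}) (n : ℕ) : Submodule k (Cochain k S n) :=
  LinearMap.ker (coboundary k S n)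

/-- The module `Bⁿ` of `n`-coboundaries. -/
def coboundaries (S : SSet.{u}) : (n : ℕ) → Submodule k (Cochain k S n)
  | 0 => ⊥
  | n + 1 => LinearMap.range (coboundary k S n)

lemma coboundary_coboundary (S : SSet.{u}) (n : ℕ) (φ : Cochain k S n) :
    coboundary k S (n + 1) (coboundary k S n φ) = 0 := by
  funext σ
  simp only [coboundary_apply, Finset.mul_sum, Pi.zero_apply, ← Finset.sum_product',
    Finset.univ_product_univ]
  let A : Finset (Fin (n + 3) × Fin (n + 2)) := {ij | (ij.1 : ℕ) ≤ (ij.2 : ℕ)}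
  rw [← Finset.sum_add_sum_compl A, ← eq_neg_iff_add_eq_zero, ← Finset.sum_neg_distrib]
  refine Finset.sum_bij
    (fun ij hij => (ij.2.succ, ij.1.castLT (lt_of_le_of_lt (Finset.mem_filter.mp hij).2 ij.2.2)))
    ?_ ?_ ?_ ?_
  · rintro ⟨i, j⟩ hij
    simp only [A, Finset.compl_filter, Finset.mem_filter_univ, Fin.val_succ,
      Fin.val_castLT] at hij ⊢
    lia
  · rintro ⟨i, j⟩ hij ⟨i', j'⟩ hij' h
    simp only [Prod.mk.injEq, Fin.ext_iff, Fin.val_succ, Fin.val_castLT] at h ⊢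
    lia
  · rintro ⟨i', j'⟩ hij'
    simp only [A, Finset.compl_filter, Finset.mem_filter_univ, not_le] at hij'
    refine ⟨(j'.castSucc, i'.pred (by rintro rfl; simp at hij')), ?_, ?_⟩
    · simp only [A, Finset.mem_filter_univ, Fin.val_castSucc, Fin.val_pred]
      lia
    · simp
  · rintro ⟨i, j⟩ hij
    have hij' : (i : ℕ) ≤ (j : ℕ) := (Finset.mem_filter.mp hij).2
    have hle : i ≤ j.castSucc := by simpa [Fin.le_def] using hij'
    dsimp only
    rw [SSet.δ_comp_δ''_apply hle]
    simp only [Fin.val_succ, Fin.val_castLT, pow_succ]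
    ring

lemma coboundaries_le_cocycles (S : SSet.{u}) (n : ℕ) :
    coboundaries k S n ≤ cocycles k S n := by
  cases n with
  | zero => exact bot_le
  | succ n =>
    rintro _ ⟨φ, rfl⟩
    exact coboundary_coboundary k S n φ

/-- The `n`-th cohomology module `Hⁿ(S; k) = Zⁿ / Bⁿ`. -/
def Cohomology (S : SSet.{u}) (n : ℕ) : Type (max u v) :=
  cocycles k S n ⧸ (coboundaries k S n).submoduleOf (cocycles k S n)

instance (S : SSet.{u}) (n : ℕ) : AddCommGroup (Cohomology k S n) :=
  inferInstanceAs (AddCommGroup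
    (cocycles k S n ⧸ (coboundaries k S n).submoduleOf (cocycles k S n)))

instance (S : SSet.{u}) (n : ℕ) : Module k (Cohomology k S n) :=
  inferInstanceAs (Module k
    (cocycles k S n ⧸ (coboundaries k S n).submoduleOf (cocycles k S n)))

variable {k} {S : SSet.{u}}

/-- The cup product of cochains (Alexander–Whitney formula), for `n = p + q`:
`(φ ⌣ ψ)(σ) = φ(σ|[v₀, …, v_p]) * ψ(σ|[v_p, …, v_{p+q}])`. -/
def cochainCup {p q n : ℕ} (h : p + q = n) (φ : Cochain k S p) (ψ : Cochain k S q) :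
    Cochain k S n :=
  fun σ => φ (S.map (SimplexCategory.subinterval 0 p (by lia)).op σ) *
    ψ (S.map (SimplexCategory.subinterval p q h.le).op σ)

lemma map_map_apply {a b c : SimplexCategory} (f : a ⟶ b) (g : b ⟶ c) (σ : S.obj (op c)) :
    S.map f.op (S.map g.op σ) = S.map (f ≫ g).op σ := by
  simp

lemma subinterval_comp {a b n : ℕ} (i j l : ℕ) (h₁ : i + a ≤ b) (h₂ : j + b ≤ n)
    (h₃ : l + a ≤ n) (h : l = i + j) :
    SimplexCategory.subinterval i a h₁ ≫ SimplexCategory.subinterval j b h₂ =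
      SimplexCategory.subinterval l a h₃ := by
  subst h
  ext x : 3
  apply Fin.ext
  change (x : ℕ) + i + j = x + (i + j)
  lia

lemma subinterval_self (n : ℕ) (h : 0 + n ≤ n) :
    SimplexCategory.subinterval 0 n h = 𝟙 (SimplexCategory.mk n) := by
  ext x : 3
  rfl

lemma subinterval_comp_δ_of_lt {a j n : ℕ} (i : Fin (n + 2)) (h : j + a ≤ n)
    (h' : j + a ≤ n + 1) (hi : j + a < i) :
    SimplexCategory.subinterval j a h ≫ SimplexCategory.δ i =
      SimplexCategory.subinterval j a h' := by
  ext x : 3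
  apply Fin.ext
  change ((i.succAbove ⟨x + j, _⟩ : Fin (n + 2)) : ℕ) = x + j
  rw [Fin.succAbove_of_castSucc_lt]
  · rfl
  · rw [Fin.lt_def]
    have := x.2
    simp at this ⊢
    lia

lemma subinterval_comp_δ_of_le {a j n : ℕ} (i : Fin (n + 2)) (h : j + a ≤ n)
    (h' : j + 1 + a ≤ n + 1) (hi : (i : ℕ) ≤ j) :
    SimplexCategory.subinterval j a h ≫ SimplexCategory.δ i =
      SimplexCategory.subinterval (j + 1) a h' := by
  ext x : 3
  apply Fin.ext
  change ((i.succAbove ⟨x + j, _⟩ : Fin (n + 2)) : ℕ) = x + (j + 1)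
  rw [Fin.succAbove_of_le_castSucc]
  · rfl
  · rw [Fin.le_def]
    simp
    lia

lemma subinterval_comp_δ_mid {a j n : ℕ} (i : Fin (n + 2)) (i' : Fin (a + 2)) (h : j + a ≤ n)
    (h' : j + (a + 1) ≤ n + 1) (hi : (i : ℕ) = j + i') :
    SimplexCategory.subinterval j a h ≫ SimplexCategory.δ i =
      SimplexCategory.δ i' ≫ SimplexCategory.subinterval j (a + 1) h' := by
  ext x : 3
  apply Fin.ext
  change ((i.succAbove ⟨x + j, _⟩ : Fin (n + 2)) : ℕ) = (i'.succAbove x : ℕ) + j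
  by_cases hx : (x : ℕ) < i'
  · rw [Fin.succAbove_of_castSucc_lt _ _ (by simp [Fin.lt_def]; lia),
      Fin.succAbove_of_castSucc_lt _ _ (by simpa [Fin.lt_def] using hx)]
    rfl
  · rw [Fin.succAbove_of_le_castSucc _ _ (by simp [Fin.le_def]; lia),
      Fin.succAbove_of_le_castSucc _ _ (by simpa [Fin.le_def] using hx)]
    simp
    lia

/-- The Leibniz rule `d(φ ⌣ ψ) = dφ ⌣ ψ + (-1)ᵖ φ ⌣ dψ`. -/
lemma coboundary_cochainCup {p q n : ℕ} (h : p + q = n) (h₁ : p + 1 + q = n + 1)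
    (h₂ : p + (q + 1) = n + 1) (φ : Cochain k S p) (ψ : Cochain k S q) :
    coboundary k S n (cochainCup h φ ψ) =
      cochainCup h₁ (coboundary k S p φ) ψ +
        (-1 : k) ^ p • cochainCup h₂ φ (coboundary k S q ψ) := by
  subst h
  funext σ
  have hδ : ∀ {m : ℕ} (i : Fin (m + 2)) (τ : S.obj (op (SimplexCategory.mk (m + 1)))),
      S.δ i τ = S.map (SimplexCategory.δ i).op τ := fun _ _ => rfl
  have hsplit : ∀ F : Fin (p + q + 2) → k, ∑ i, F i =
      ∑ i : Fin (p + 1), F ⟨i, by lia⟩ + ∑ j : Fin (q + 1), F ⟨p + 1 + j, by lia⟩ := by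
    intro F
    rw [← Equiv.sum_comp (finCongr (by lia : p + 1 + (q + 1) = p + q + 2)), Fin.sum_univ_add]
    rfl
  simp only [Pi.add_apply, Pi.smul_apply, smul_eq_mul, cochainCup, coboundary_apply, hδ,
    map_map_apply, hsplit]
  rw [Fin.sum_univ_castSucc (n := p + 1), Fin.sum_univ_succ (n := q + 1), add_mul, mul_add,
    mul_add, Finset.sum_mul, Finset.mul_sum, Finset.mul_sum]
  have e₁ : ∀ i : Fin (p + 1),
      (-1 : k) ^ ((⟨i, by lia⟩ : Fin (p + q + 2)) : ℕ) *
        (φ (S.map (SimplexCategory.subinterval 0 p (by lia) ≫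
          SimplexCategory.δ (⟨i, by lia⟩ : Fin (p + q + 2))).op σ) *
        ψ (S.map (SimplexCategory.subinterval p q le_rfl ≫
          SimplexCategory.δ (⟨i, by lia⟩ : Fin (p + q + 2))).op σ)) =
      (-1 : k) ^ (i.castSucc : ℕ) *
        φ (S.map (SimplexCategory.δ i.castSucc ≫
          SimplexCategory.subinterval 0 (p + 1) (by lia)).op σ) *
        ψ (S.map (SimplexCategory.subinterval (p + 1) q h₁.le).op σ) := by
    intro i
    rw [subinterval_comp_δ_mid (⟨i, by lia⟩ : Fin (p + q + 2)) i.castSucc (by lia) (by lia)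
        (by simp),
      subinterval_comp_δ_of_le (⟨i, by lia⟩ : Fin (p + q + 2)) le_rfl h₁.le
        (by simp; lia), mul_assoc]
    rfl
  have e₂ : ∀ j : Fin (q + 1),
      (-1 : k) ^ ((⟨p + 1 + j, by lia⟩ : Fin (p + q + 2)) : ℕ) *
        (φ (S.map (SimplexCategory.subinterval 0 p (by lia) ≫
          SimplexCategory.δ (⟨p + 1 + j, by lia⟩ : Fin (p + q + 2))).op σ) *
        ψ (S.map (SimplexCategory.subinterval p q le_rfl ≫
          SimplexCategory.δ (⟨p + 1 + j, by lia⟩ : Fin (p + q + 2))).op σ)) =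
      (-1 : k) ^ p * (φ (S.map (SimplexCategory.subinterval 0 p (by lia)).op σ) *
        ((-1 : k) ^ (j.succ : ℕ) * ψ (S.map (SimplexCategory.δ j.succ ≫
          SimplexCategory.subinterval p (q + 1) h₂.le).op σ))) := by
    intro j
    rw [subinterval_comp_δ_mid (⟨p + 1 + j, by lia⟩ : Fin (p + q + 2)) j.succ le_rfl h₂.le
        (by simp; lia),
      subinterval_comp_δ_of_lt (⟨p + 1 + j, by lia⟩ : Fin (p + q + 2)) (by lia) (by lia)
        (by simp; lia)]
    simp only [Fin.val_succ, pow_add, pow_one]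
    ring
  have e₃ : SimplexCategory.δ (Fin.last (p + 1)) ≫
      SimplexCategory.subinterval 0 (p + 1) (by lia : 0 + (p + 1) ≤ p + q + 1) =
      SimplexCategory.subinterval 0 p (by lia) := by
    ext x : 3
    apply Fin.ext
    change (((Fin.last (p + 1)).succAbove x : Fin (p + 2)) : ℕ) + 0 = x + 0
    simp
  have e₄ : SimplexCategory.δ (0 : Fin (q + 2)) ≫ SimplexCategory.subinterval p (q + 1) h₂.le =
      SimplexCategory.subinterval (p + 1) q h₁.le := by
    ext x : 3
    apply Fin.ext
    change (((0 : Fin (q + 2)).succAbove x : Fin (q + 2)) : ℕ) + p = x + (p + 1)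
    simp
    lia
  rw [Finset.sum_congr rfl fun i _ => e₁ i, Finset.sum_congr rfl fun j _ => e₂ j, e₃, e₄]
  simp only [Fin.val_last, Fin.val_zero, pow_succ, pow_zero]
  ring

lemma cochainCup_assoc {p q r s t n : ℕ} (h₁ : p + q = s) (h₂ : s + r = n) (h₃ : q + r = t)
    (h₄ : p + t = n) (φ : Cochain k S p) (ψ : Cochain k S q) (χ : Cochain k S r) :
    cochainCup h₂ (cochainCup h₁ φ ψ) χ = cochainCup h₄ φ (cochainCup h₃ ψ χ) := by
  subst h₁ h₂ h₃
  funext σ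
  simp only [cochainCup, map_map_apply, mul_assoc]
  rw [subinterval_comp 0 0 0 _ _ (by lia) rfl,
    subinterval_comp p 0 p _ _ (by lia) rfl,
    subinterval_comp 0 p p _ _ (by lia) (by lia),
    subinterval_comp q p (p + q) _ _ (by lia) (by lia)]

lemma cochainCup_add_left {p q n : ℕ} (h : p + q = n) (φ φ' : Cochain k S p)
    (ψ : Cochain k S q) :
    cochainCup h (φ + φ') ψ = cochainCup h φ ψ + cochainCup h φ' ψ := by
  funext σ
  simp [cochainCup, add_mul]

lemma cochainCup_add_right {p q n : ℕ} (h : p + q = n) (φ : Cochain k S p)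
    (ψ ψ' : Cochain k S q) :
    cochainCup h φ (ψ + ψ') = cochainCup h φ ψ + cochainCup h φ ψ' := by
  funext σ
  simp [cochainCup, mul_add]

lemma cochainCup_zero_left {p q n : ℕ} (h : p + q = n) (ψ : Cochain k S q) :
    cochainCup h (0 : Cochain k S p) ψ = 0 := by
  funext σ
  simp [cochainCup]

lemma cochainCup_zero_right {p q n : ℕ} (h : p + q = n) (φ : Cochain k S p) :
    cochainCup h φ (0 : Cochain k S q) = 0 := by
  funext σ
  simp [cochainCup]

lemma cochainCup_mem_cocycles {p q n : ℕ} (h : p + q = n) {φ : Cochain k S p}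
    {ψ : Cochain k S q} (hφ : φ ∈ cocycles k S p) (hψ : ψ ∈ cocycles k S q) :
    cochainCup h φ ψ ∈ cocycles k S n := by
  have hφ' : coboundary k S p φ = 0 := hφ
  have hψ' : coboundary k S q ψ = 0 := hψ
  change coboundary k S n (cochainCup h φ ψ) = 0
  rw [coboundary_cochainCup h (by lia) (by lia), hφ', hψ', cochainCup_zero_left,
    cochainCup_zero_right, smul_zero, add_zero]

lemma cochainCup_mem_coboundaries_left {p q n : ℕ} (h : p + q = n) {φ : Cochain k S p}
    {ψ : Cochain k S q} (hφ : φ ∈ coboundaries k S p) (hψ : ψ ∈ cocycles k S q) :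
    cochainCup h φ ψ ∈ coboundaries k S n := by
  cases p with
  | zero =>
    have hφ' : φ = 0 := hφ
    rw [hφ', cochainCup_zero_left]
    exact zero_mem _
  | succ p =>
    obtain ⟨φ', rfl⟩ := hφ
    have hψ' : coboundary k S q ψ = 0 := hψ
    obtain ⟨m, rfl⟩ : ∃ m, n = m + 1 := ⟨p + q, by lia⟩
    refine ⟨cochainCup (by lia : p + q = m) φ' ψ, ?_⟩
    rw [coboundary_cochainCup _ h (by lia), hψ', cochainCup_zero_right, smul_zero, add_zero]

lemma cochainCup_mem_coboundaries_right {p q n : ℕ} (h : p + q = n) {φ : Cochain k S p}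
    {ψ : Cochain k S q} (hφ : φ ∈ cocycles k S p) (hψ : ψ ∈ coboundaries k S q) :
    cochainCup h φ ψ ∈ coboundaries k S n := by
  cases q with
  | zero =>
    have hψ' : ψ = 0 := hψ
    rw [hψ', cochainCup_zero_right]
    exact zero_mem _
  | succ q =>
    obtain ⟨ψ', rfl⟩ := hψ
    have hφ' : coboundary k S p φ = 0 := hφ
    obtain ⟨m, rfl⟩ : ∃ m, n = m + 1 := ⟨p + q, by lia⟩
    have key : cochainCup h φ (coboundary k S q ψ') =
        coboundary k S m ((-1 : k) ^ p • cochainCup (by lia : p + q = m) φ ψ') := by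
      rw [map_smul, coboundary_cochainCup _ (by lia) h, hφ', cochainCup_zero_left, zero_add,
        smul_smul, ← mul_pow]
      simp
    rw [key]
    exact ⟨_, rfl⟩

/-- The class of a cocycle. -/
def Cohomology.mk {n : ℕ} (z : cocycles k S n) : Cohomology k S n :=
  Submodule.Quotient.mk z

lemma Cohomology.mk_eq_mk_iff {n : ℕ} (z w : cocycles k S n) :
    Cohomology.mk z = Cohomology.mk w ↔
      (z : Cochain k S n) - (w : Cochain k S n) ∈ coboundaries k S n := by
  exact Submodule.Quotient.eq ((coboundaries k S n).submoduleOf (cocycles k S n))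

/-- The cup product `Hᵖ × H^q → Hⁿ` for `n = p + q`. -/
def cup {p q n : ℕ} (h : p + q = n) : Cohomology k S p → Cohomology k S q → Cohomology k S n :=
  Quotient.map₂
    (fun z w => ⟨cochainCup h z.1 w.1, cochainCup_mem_cocycles h z.2 w.2⟩) (by
      intro z z' hz w w' hw
      have hz' : (z : Cochain k S p) - (z' : Cochain k S p) ∈ coboundaries k S p :=
        (Cohomology.mk_eq_mk_iff z z').1 (Quotient.sound hz)
      have hw' : (w : Cochain k S q) - (w' : Cochain k S q) ∈ coboundaries k S q :=
        (Cohomology.mk_eq_mk_iff w w').1 (Quotient.sound hw)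
      refine Quotient.exact ((Cohomology.mk_eq_mk_iff _ _).2 ?_)
      have key : cochainCup h z.1 w.1 - cochainCup h z'.1 w'.1 =
          cochainCup h (z.1 - z'.1) w.1 + cochainCup h z'.1 (w.1 - w'.1) := by
        funext σ
        simp only [cochainCup, Pi.sub_apply, Pi.add_apply]
        ring
      change cochainCup h z.1 w.1 - cochainCup h z'.1 w'.1 ∈ _
      rw [key]
      exact add_mem (cochainCup_mem_coboundaries_left h hz' w.2)
        (cochainCup_mem_coboundaries_right h z'.2 hw'))

lemma cup_mk {p q n : ℕ} (h : p + q = n) (z : cocycles k S p) (w : cocycles k S q) :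
    cup h (Cohomology.mk z) (Cohomology.mk w) =
      Cohomology.mk ⟨cochainCup h z.1 w.1, cochainCup_mem_cocycles h z.2 w.2⟩ :=
  rfl

lemma Cohomology.ind {n : ℕ} {P : Cohomology k S n → Prop}
    (h : ∀ z : cocycles k S n, P (Cohomology.mk z)) (a : Cohomology k S n) : P a :=
  Submodule.Quotient.induction_on _ a h

lemma cup_add_left {p q n : ℕ} (h : p + q = n) (a a' : Cohomology k S p)
    (b : Cohomology k S q) : cup h (a + a') b = cup h a b + cup h a' b := by
  induction a using Cohomology.ind with | h z => ?_
  induction a' using Cohomology.ind with | h z' => ?_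
  induction b using Cohomology.ind with | h w => ?_
  exact congrArg Cohomology.mk (Subtype.ext (cochainCup_add_left h z.1 z'.1 w.1))

lemma cup_add_right {p q n : ℕ} (h : p + q = n) (a : Cohomology k S p)
    (b b' : Cohomology k S q) : cup h a (b + b') = cup h a b + cup h a b' := by
  induction a using Cohomology.ind with | h z => ?_
  induction b using Cohomology.ind with | h w => ?_
  induction b' using Cohomology.ind with | h w' => ?_
  exact congrArg Cohomology.mk (Subtype.ext (cochainCup_add_right h z.1 w.1 w'.1))

lemma cup_zero_left {p q n : ℕ} (h : p + q = n) (b : Cohomology k S q) :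
    cup h (0 : Cohomology k S p) b = 0 := by
  simpa using cup_add_left h (0 : Cohomology k S p) 0 b

lemma cup_zero_right {p q n : ℕ} (h : p + q = n) (a : Cohomology k S p) :
    cup h a (0 : Cohomology k S q) = 0 := by
  simpa using cup_add_right h a (0 : Cohomology k S q) 0

lemma cup_assoc {p q r s t n : ℕ} (h₁ : p + q = s) (h₂ : s + r = n) (h₃ : q + r = t)
    (h₄ : p + t = n) (a : Cohomology k S p) (b : Cohomology k S q) (c : Cohomology k S r) :
    cup h₂ (cup h₁ a b) c = cup h₄ a (cup h₃ b c) := by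
  induction a using Cohomology.ind with | h x => ?_
  induction b using Cohomology.ind with | h y => ?_
  induction c using Cohomology.ind with | h z => ?_
  exact congrArg Cohomology.mk (Subtype.ext (cochainCup_assoc h₁ h₂ h₃ h₄ x.1 y.1 z.1))

variable (k S) in
/-- The unit class in `H⁰`: the class of the `0`-cochain with constant value `1`. -/
def cohomologyOne : Cohomology k S 0 :=
  Cohomology.mk ⟨fun _ => 1, by
    change coboundary k S 0 _ = 0
    funext σ
    simp [coboundary_apply, Fin.sum_univ_two]⟩

lemma cohomologyOne_cup {p : ℕ} (h : 0 + p = p) (a : Cohomology k S p) :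
    cup h (cohomologyOne k S) a = a := by
  induction a using Cohomology.ind with | h z => ?_
  refine congrArg Cohomology.mk (Subtype.ext ?_)
  funext σ
  simp [cochainCup, subinterval_self]

lemma cup_cohomologyOne {p : ℕ} (a : Cohomology k S p) :
    cup (Nat.add_zero p) a (cohomologyOne k S) = a := by
  induction a using Cohomology.ind with | h z => ?_
  refine congrArg Cohomology.mk (Subtype.ext ?_)
  funext σ
  simp [cochainCup, subinterval_self]

lemma sigma_cup_eq {p q m n : ℕ} (h : p + q = m) (h' : p + q = n) (a : Cohomology k S p)
    (b : Cohomology k S q) :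
    GradedMonoid.mk (A := Cohomology k S) m (cup h a b) = GradedMonoid.mk n (cup h' a b) := by
  subst h h'
  rfl

instance : GradedMonoid.GMul (Cohomology k S) where
  mul a b := cup rfl a b

instance : GradedMonoid.GOne (Cohomology k S) where
  one := cohomologyOne k S

instance : GradedMonoid.GMonoid (Cohomology k S) where
  one_mul := by
    rintro ⟨n, a⟩
    exact (sigma_cup_eq rfl (Nat.zero_add n) _ _).trans
      (congrArg (GradedMonoid.mk n) (cohomologyOne_cup _ a))
  mul_one := by
    rintro ⟨n, a⟩
    exact congrArg (GradedMonoid.mk n) (cup_cohomologyOne a)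
  mul_assoc := by
    rintro ⟨p, a⟩ ⟨q, b⟩ ⟨r, c⟩
    exact (congrArg (GradedMonoid.mk (p + q + r))
      (cup_assoc rfl rfl rfl (Nat.add_assoc p q r).symm a b c)).trans (sigma_cup_eq _ _ _ _)

/-- The cup product makes `⨁ n, Hⁿ(S; k)` a graded ring. -/
instance : DirectSum.GRing (Cohomology k S) where
  mul_zero a := cup_zero_right rfl a
  zero_mul b := cup_zero_left rfl b
  mul_add a b c := cup_add_right rfl a b c
  add_mul a b c := cup_add_left rfl a b c
  one_mul := GradedMonoid.GMonoid.one_mul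
  mul_one := GradedMonoid.GMonoid.mul_one
  mul_assoc := GradedMonoid.GMonoid.mul_assoc
  natCast n := n • cohomologyOne k S
  natCast_zero := zero_nsmul _
  natCast_succ n := succ_nsmul _ _
  intCast n := n • cohomologyOne k S
  intCast_ofNat n := natCast_zsmul _ n
  intCast_negSucc_ofNat n := negSucc_zsmul _ n

/-! ### Functoriality -/

variable {T : SSet.{u}}

/-- Pullback of cochains along a map of simplicial sets. -/
def cochainMap (f : S ⟶ T) (n : ℕ) : Cochain k T n →ₗ[k] Cochain k S n :=
  LinearMap.funLeft k k (fun σ => f.app (op (SimplexCategory.mk n)) σ)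

lemma cochainMap_apply (f : S ⟶ T) (n : ℕ) (φ : Cochain k T n)
    (σ : S.obj (op (SimplexCategory.mk n))) :
    cochainMap f n φ σ = φ (f.app (op (SimplexCategory.mk n)) σ) :=
  rfl

lemma coboundary_cochainMap (f : S ⟶ T) (n : ℕ) (φ : Cochain k T n) :
    coboundary k S n (cochainMap f n φ) = cochainMap f (n + 1) (coboundary k T n φ) := by
  funext σ
  simp only [coboundary_apply, cochainMap_apply]
  refine Finset.sum_congr rfl fun i _ => ?_
  congr 2
  exact NatTrans.naturality_apply f (SimplexCategory.δ i).op σ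

lemma cochainMap_mem_cocycles (f : S ⟶ T) (n : ℕ) {φ : Cochain k T n}
    (hφ : φ ∈ cocycles k T n) : cochainMap f n φ ∈ cocycles k S n := by
  have hφ' : coboundary k T n φ = 0 := hφ
  change coboundary k S n (cochainMap f n φ) = 0
  rw [coboundary_cochainMap, hφ', map_zero]

lemma cochainMap_mem_coboundaries (f : S ⟶ T) (n : ℕ) {φ : Cochain k T n}
    (hφ : φ ∈ coboundaries k T n) : cochainMap f n φ ∈ coboundaries k S n := by
  cases n with
  | zero =>
    have hφ' : φ = 0 := hφ
    rw [hφ', map_zero]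
    exact zero_mem _
  | succ n =>
    obtain ⟨φ', rfl⟩ := hφ
    exact ⟨cochainMap f n φ', coboundary_cochainMap f n φ'⟩

variable (k) in
/-- The map `f^* : Hⁿ(T; k) → Hⁿ(S; k)` induced by `f : S ⟶ T`. -/
def cohomologyMap (f : S ⟶ T) (n : ℕ) : Cohomology k T n →ₗ[k] Cohomology k S n :=
  Submodule.mapQ _ _ ((cochainMap f n).restrict fun _ => cochainMap_mem_cocycles f n)
    fun _ hz => cochainMap_mem_coboundaries f n hz

lemma cohomologyMap_one (f : S ⟶ T) :
    cohomologyMap k f 0 (cohomologyOne k T) = cohomologyOne k S :=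
  rfl

lemma cohomologyMap_cup (f : S ⟶ T) {p q n : ℕ} (h : p + q = n) (a : Cohomology k T p)
    (b : Cohomology k T q) :
    cohomologyMap k f n (cup h a b) = cup h (cohomologyMap k f p a) (cohomologyMap k f q b) := by
  induction a using Cohomology.ind with | h z => ?_
  induction b using Cohomology.ind with | h w => ?_
  refine congrArg Cohomology.mk (Subtype.ext ?_)
  funext σ
  change z.1 _ * w.1 _ = z.1 _ * w.1 _
  congr 2
  · exact congrArg z.1
      (NatTrans.naturality_apply f (SimplexCategory.subinterval 0 p (by lia)).op σ).symm
  · exact congrArg w.1 (NatTrans.naturality_apply f (SimplexCategory.subinterval p q h.le).op σ).symm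

variable (k) in
/-- The ring homomorphism `f^* : ⨁ n, Hⁿ(T; k) → ⨁ n, Hⁿ(S; k)` induced by `f : S ⟶ T`. -/
def cohomologyRingMap (f : S ⟶ T) :
    (⨁ n, Cohomology k T n) →+* (⨁ n, Cohomology k S n) :=
  DirectSum.toSemiring
    (fun n => (DirectSum.of (Cohomology k S) n).comp (cohomologyMap k f n).toAddMonoidHom)
    (congrArg (DirectSum.of (Cohomology k S) 0) (cohomologyMap_one f))
    (fun {i j} a b => by
      refine (congrArg (DirectSum.of (Cohomology k S) (i + j))
        (cohomologyMap_cup f rfl a b)).trans ?_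
      exact (DirectSum.of_mul_of _ _).symm)

end Cochains

end SSet

/-- The singular cohomology ring `H^*(X; k) = ⨁ n, Hⁿ(X; k)` of a topological space, with the cup
product. -/
abbrev SingularCohomologyRing (k : Type v) [CommRing k] (X : TopCat.{u}) : Type (max u v) :=
  ⨁ n, SSet.Cohomology k (TopCat.toSSet.obj X) n

/-- The ring homomorphism `f^* : H^*(Y; k) → H^*(X; k)` induced by a continuous map `f : X → Y`. -/
def singularPullback (k : Type v) [CommRing k] {X Y : TopCat.{u}} (f : X ⟶ Y) :
    SingularCohomologyRing k Y →+* SingularCohomologyRing k X :=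
  SSet.cohomologyRingMap k (TopCat.toSSet.map f)

/-! ### Nilpotency, zero-divisors and the zero-divisor-cup-length -/

/-- The nilpotency `nil I` of an ideal `I`: the smallest `n` with `I ^ (n + 1) = 0`, and `∞` if
there is no such `n`. -/
def idealNil {R : Type*} [Ring R] (I : Ideal R) : ℕ∞ :=
  ⨅ (n : ℕ) (_ : I ^ (n + 1) = ⊥), (n : ℕ∞)

/-- The diagonal map `Δ_X : X → X × X`. -/
def diagonalMap (X : TopCat.{u}) : X ⟶ TopCat.of (X × X) :=
  TopCat.ofHom ⟨fun x => (x, x), by fun_prop⟩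

/-- The map `f × f : X × X → Y × Y`. -/
def squareMap {X Y : TopCat.{u}} (f : X ⟶ Y) : TopCat.of (X × X) ⟶ TopCat.of (Y × Y) :=
  TopCat.ofHom (f.hom.prodMap f.hom)

/-- The ideal of zero-divisors of `H^*(X; k)`: the kernel of
`Δ_X^* : H^*(X × X; k) → H^*(X; k)`. -/
def zeroDivisorIdeal (k : Type v) [CommRing k] (X : TopCat.{u}) :
    Ideal (SingularCohomologyRing k (TopCat.of (X × X))) :=
  RingHom.ker (singularPullback k (diagonalMap X))

/-- The zero-divisor-cup-length of a space: `zcl(X) = nil (ker Δ_X^*)`. -/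
def zclSpace (k : Type v) [CommRing k] (X : TopCat.{u}) : ℕ∞ :=
  idealNil (zeroDivisorIdeal k X)

/-- The zero-divisor-cup-length of a map: `zcl(f) = nil (im (f × f)^* ∩ ker Δ_X^*)`, where
`im (f × f)^* ∩ ker Δ_X^*` is an ideal of the ring `im (f × f)^*`. -/
def zclMap (k : Type v) [CommRing k] {X Y : TopCat.{u}} (f : X ⟶ Y) : ℕ∞ :=
  idealNil ((zeroDivisorIdeal k X).comap (singularPullback k (squareMap f)).range.subtype)

/-- A categorical invariant of a category `C`, given by its values on objects and on morphisms. -/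
structure IsCategoricalInvariant (C : Type*) [Category C] (onObj : C → ℕ∞)
    (onHom : ∀ {X Y : C}, (X ⟶ Y) → ℕ∞) : Prop where
  map_id : ∀ X : C, onHom (𝟙 X) = onObj X
  map_comp_le : ∀ {X Y Z W : C} (f : X ⟶ Y) (g : Y ⟶ Z) (h : Z ⟶ W),
    onHom (f ≫ g ≫ h) ≤ onHom g

end

/-! ### Functoriality of the cohomology ring -/

/-! Everything follows from functoriality of the cohomology ring and two ways of comparing
nilpotencies. Nilpotency does not increase under passage to an ideal that embeds in another by an
injective ring map (`idealNil_le_of_injective`), or to one whose elements all lift along a ring map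
(`idealNil_le_of_forall_exists`).

For `f : X ⟶ Y` and `g : Y ⟶ Z`, the ring attached to `f ≫ g` is a subring of the one attached to
`f`, and both ideals are cut out by the same kernel of `Δ_X^*`; the embedding criterion bounds
`zclMap` by its value at `f`.

The bound by `g` needs the lifting criterion: `(f × f)^*` maps the ring of `g` onto the ring of `f ≫
g`, but a preimage of a zero-divisor need not be a zero-divisor. The projection `pr₁`, a left
inverse of the diagonal, repairs this: replacing a class `a` on `Z × Z` by `a - pr₁^* Δ^* a` gives a
zero-divisor, and leaves the image on `X × X` unchanged when that image is a zero-divisor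
(`exists_mem_zeroDivisorIdeal_singularPullback_eq`). -/

lemma SSet.cohomologyMap_comp (k : Type v) [CommRing k] {S T U : SSet.{u}} (f : S ⟶ T)
    (g : T ⟶ U) (n : ℕ) (a : SSet.Cohomology k U n) :
    SSet.cohomologyMap k (f ≫ g) n a = SSet.cohomologyMap k f n (SSet.cohomologyMap k g n a) := by
  induction a using SSet.Cohomology.ind with | h z => rfl

lemma SSet.cohomologyMap_id (k : Type v) [CommRing k] (S : SSet.{u}) (n : ℕ)
    (a : SSet.Cohomology k S n) : SSet.cohomologyMap k (𝟙 S) n a = a := by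
  induction a using SSet.Cohomology.ind with | h z => rfl

lemma SSet.cohomologyRingMap_of (k : Type v) [CommRing k] {S T : SSet.{u}} (f : S ⟶ T) (n : ℕ)
    (a : SSet.Cohomology k T n) :
    SSet.cohomologyRingMap k f (DirectSum.of (SSet.Cohomology k T) n a) =
      DirectSum.of (SSet.Cohomology k S) n (SSet.cohomologyMap k f n a) :=
  DirectSum.toSemiring_of _ _ _ _ _

lemma SSet.cohomologyRingMap_comp (k : Type v) [CommRing k] {S T U : SSet.{u}} (f : S ⟶ T)
    (g : T ⟶ U) :
    SSet.cohomologyRingMap k (f ≫ g) =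
      (SSet.cohomologyRingMap k f).comp (SSet.cohomologyRingMap k g) := by
  refine DirectSum.ringHom_ext fun n a => ?_
  rw [RingHom.comp_apply]
  simp only [SSet.cohomologyRingMap_of, SSet.cohomologyMap_comp]

lemma SSet.cohomologyRingMap_id (k : Type v) [CommRing k] (S : SSet.{u}) :
    SSet.cohomologyRingMap k (𝟙 S) = RingHom.id _ := by
  refine DirectSum.ringHom_ext fun n a => ?_
  simp only [SSet.cohomologyRingMap_of, SSet.cohomologyMap_id, RingHom.id_apply]

lemma singularPullback_comp_apply (k : Type v) [CommRing k] {X Y Z : TopCat.{u}} (f : X ⟶ Y)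
    (g : Y ⟶ Z) (a : SingularCohomologyRing k Z) :
    singularPullback k (f ≫ g) a = singularPullback k f (singularPullback k g a) := by
  rw [singularPullback, Functor.map_comp, SSet.cohomologyRingMap_comp]
  rfl

lemma singularPullback_id_apply (k : Type v) [CommRing k] {X : TopCat.{u}}
    (a : SingularCohomologyRing k X) : singularPullback k (𝟙 X) a = a := by
  have h : singularPullback k (𝟙 X) = RingHom.id _ :=
    (congrArg (SSet.cohomologyRingMap k) (TopCat.toSSet.map_id X)).trans
      (SSet.cohomologyRingMap_id k _)
  exact RingHom.congr_fun h a

/-! ### Comparison of nilpotencies -/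

section Nilpotency

variable {R S : Type*} [Ring R] [Ring S] {I : Ideal R} {J : Ideal S}

/-- The infimum for `I` runs over a larger set of exponents. The case where no power of `J` vanishes
needs no separate treatment, since the empty infimum is `⊤`. -/
lemma idealNil_le_of_forall (h : ∀ n : ℕ, J ^ (n + 1) = ⊥ → I ^ (n + 1) = ⊥) :
    idealNil I ≤ idealNil J :=
  le_iInf₂ fun n hn => iInf₂_le n (h n hn)

lemma map_mem_ideal_pow (φ : R →+* S) (h : ∀ x ∈ I, φ x ∈ J) (n : ℕ) :
    ∀ x ∈ I ^ (n + 1), φ x ∈ J ^ (n + 1) := by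
  induction n with
  | zero => simpa only [zero_add, Submodule.pow_one] using h
  | succ n ih =>
    intro x hx
    rw [Submodule.pow_succ] at hx ⊢
    induction hx using Submodule.mul_induction_on' with
    | mem_mul_mem a ha b hb =>
      rw [map_mul]
      exact Submodule.mul_mem_mul (ih a ha) (h b hb)
    | add a _ b _ ha hb =>
      rw [map_add]
      exact add_mem ha hb

/-- Powers are spanned additively by products, and products and sums lift factor by factor and term
by term. Starting at exponent `1` matters: `φ` need not be surjective, so exponent `0` could fail.
-/
lemma exists_mem_ideal_pow_map_eq (φ : S →+* R) (h : ∀ x ∈ I, ∃ y ∈ J, φ y = x) (n : ℕ) :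
    ∀ x ∈ I ^ (n + 1), ∃ y ∈ J ^ (n + 1), φ y = x := by
  induction n with
  | zero => simpa only [zero_add, Submodule.pow_one] using h
  | succ n ih =>
    intro x hx
    rw [Submodule.pow_succ] at hx ⊢
    induction hx using Submodule.mul_induction_on' with
    | mem_mul_mem a ha b hb =>
      obtain ⟨a', ha', rfl⟩ := ih a ha
      obtain ⟨b', hb', rfl⟩ := h b hb
      exact ⟨a' * b', Submodule.mul_mem_mul ha' hb', map_mul φ a' b'⟩
    | add a _ b _ ha hb =>
      obtain ⟨a', ha', rfl⟩ := ha
      obtain ⟨b', hb', rfl⟩ := hb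
      exact ⟨a' + b', add_mem ha' hb', map_add φ a' b'⟩

lemma idealNil_le_of_injective (φ : R →+* S) (hφ : Function.Injective φ)
    (h : ∀ x ∈ I, φ x ∈ J) : idealNil I ≤ idealNil J := by
  refine idealNil_le_of_forall fun n hn => (Submodule.eq_bot_iff _).2 fun x hx => hφ ?_
  have hx' := map_mem_ideal_pow φ h n x hx
  rw [hn] at hx'
  rw [map_zero]
  exact hx'

lemma idealNil_le_of_forall_exists (φ : S →+* R) (h : ∀ x ∈ I, ∃ y ∈ J, φ y = x) :
    idealNil I ≤ idealNil J := by
  refine idealNil_le_of_forall fun n hn => (Submodule.eq_bot_iff _).2 fun x hx => ?_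
  obtain ⟨y, hy, rfl⟩ := exists_mem_ideal_pow_map_eq φ h n x hx
  rw [hn] at hy
  rw [(Submodule.mem_bot S).1 hy, map_zero]

/-- Since `θ = ψ ∘ φ`, the map `ψ` carries `φ.range` onto `θ.range`. The preimage `b` may differ
from `a` because `φ a` need not lie in `J`. -/
lemma idealNil_comap_range_le {A B C : Type*} [Ring A] [Ring B] [Ring C] {I : Ideal C}
    {J : Ideal B} (φ : A →+* B) (ψ : B →+* C) (θ : A →+* C) (hθ : ∀ a, θ a = ψ (φ a))
    (h : ∀ a, θ a ∈ I → ∃ b, φ b ∈ J ∧ θ b = θ a) :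
    idealNil (I.comap θ.range.subtype) ≤ idealNil (J.comap φ.range.subtype) := by
  have hmem : ∀ x : φ.range, (ψ.comp φ.range.subtype) x ∈ θ.range := by
    rintro ⟨_, a, rfl⟩
    exact ⟨a, hθ a⟩
  refine idealNil_le_of_forall_exists ((ψ.comp φ.range.subtype).codRestrict θ.range hmem) ?_
  rintro ⟨_, a, rfl⟩ ha
  obtain ⟨b, hb, hba⟩ := h a ha
  exact ⟨⟨φ b, b, rfl⟩, hb, Subtype.ext ((hθ b).symm.trans hba)⟩

end Nilpotency

/-! ### Zero-divisors along continuous maps -/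

section ZeroDivisors

variable (k : Type v) [CommRing k] {X Y Z : TopCat.{u}}

/-- The first projection `X × X → X`. -/
def firstProjection (X : TopCat.{u}) : TopCat.of (X × X) ⟶ X :=
  TopCat.ofHom ⟨Prod.fst, continuous_fst⟩

/-- The composite `pr₁ ∘ Δ` is the identity, so `pr₁^*` is a ring-theoretic section of `Δ^*`. -/
lemma singularPullback_diagonalMap_firstProjection (a : SingularCohomologyRing k X) :
    singularPullback k (diagonalMap X) (singularPullback k (firstProjection X) a) = a := by
  rw [← singularPullback_comp_apply]
  exact singularPullback_id_apply k a

lemma singularPullback_diagonalMap_squareMap (f : X ⟶ Y)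
    (a : SingularCohomologyRing k (TopCat.of (Y × Y))) :
    singularPullback k (diagonalMap X) (singularPullback k (squareMap f) a) =
      singularPullback k f (singularPullback k (diagonalMap Y) a) := by
  rw [← singularPullback_comp_apply, ← singularPullback_comp_apply]
  rfl

lemma singularPullback_squareMap_firstProjection (f : X ⟶ Y) (a : SingularCohomologyRing k Y) :
    singularPullback k (squareMap f) (singularPullback k (firstProjection Y) a) =
      singularPullback k (firstProjection X) (singularPullback k f a) := by
  rw [← singularPullback_comp_apply, ← singularPullback_comp_apply]
  rfl

lemma singularPullback_squareMap_comp (f : X ⟶ Y) (g : Y ⟶ Z)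
    (a : SingularCohomologyRing k (TopCat.of (Z × Z))) :
    singularPullback k (squareMap (f ≫ g)) a =
      singularPullback k (squareMap f) (singularPullback k (squareMap g) a) :=
  singularPullback_comp_apply k (squareMap f) (squareMap g) a

lemma singularPullback_squareMap_id (a : SingularCohomologyRing k (TopCat.of (X × X))) :
    singularPullback k (squareMap (𝟙 X)) a = a :=
  singularPullback_id_apply k a

lemma mem_zeroDivisorIdeal {a : SingularCohomologyRing k (TopCat.of (X × X))} :
    a ∈ zeroDivisorIdeal k X ↔ singularPullback k (diagonalMap X) a = 0 :=
  RingHom.mem_ker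

/-- Zero-divisors pull back to zero-divisors. -/
lemma singularPullback_squareMap_mem_zeroDivisorIdeal (f : X ⟶ Y)
    {a : SingularCohomologyRing k (TopCat.of (Y × Y))} (ha : a ∈ zeroDivisorIdeal k Y) :
    singularPullback k (squareMap f) a ∈ zeroDivisorIdeal k X := by
  rw [mem_zeroDivisorIdeal] at ha ⊢
  rw [singularPullback_diagonalMap_squareMap, ha, map_zero]

/-- A zero-divisor in the image of `(f × f)^*` is the image of a zero-divisor: subtract from a
preimage `a` the class `pr₁^* Δ^* a`. -/
lemma exists_mem_zeroDivisorIdeal_singularPullback_eq (f : X ⟶ Y)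
    {a : SingularCohomologyRing k (TopCat.of (Y × Y))}
    (ha : singularPullback k (squareMap f) a ∈ zeroDivisorIdeal k X) :
    ∃ b ∈ zeroDivisorIdeal k Y,
      singularPullback k (squareMap f) b = singularPullback k (squareMap f) a := by
  refine ⟨a - singularPullback k (firstProjection Y) (singularPullback k (diagonalMap Y) a),
    ?_, ?_⟩
  · rw [mem_zeroDivisorIdeal, map_sub, singularPullback_diagonalMap_firstProjection, sub_self]
  -- By naturality of the diagonal, `ha` becomes `f^* Δ_Y^* a = 0`; the correction term maps to
  -- `pr₁^*` of this class, hence to zero.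
  · rw [mem_zeroDivisorIdeal, singularPullback_diagonalMap_squareMap] at ha
    rw [map_sub, singularPullback_squareMap_firstProjection, ha, map_zero, sub_zero]

lemma zclMap_id (X : TopCat.{u}) : zclMap k (𝟙 X) = zclSpace k X := by
  refine le_antisymm
    (idealNil_le_of_injective (Subring.subtype _) Subtype.val_injective fun x hx => hx) ?_
  -- The pullback along `𝟙 × 𝟙` is the identity, so its corestriction to the range is injective.
  refine idealNil_le_of_injective (singularPullback k (squareMap (𝟙 X))).rangeRestrict
    (fun a b hab => ?_) fun x hx => ?_
  · simpa only [RingHom.coe_rangeRestrict, singularPullback_squareMap_id] using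
      congrArg Subtype.val hab
  · exact singularPullback_squareMap_mem_zeroDivisorIdeal k (𝟙 X) hx

lemma zclMap_comp_le_left (f : X ⟶ Y) (g : Y ⟶ Z) : zclMap k (f ≫ g) ≤ zclMap k f := by
  have hle : (singularPullback k (squareMap (f ≫ g))).range ≤
      (singularPullback k (squareMap f)).range := by
    rintro _ ⟨a, rfl⟩
    exact ⟨_, (singularPullback_squareMap_comp k f g a).symm⟩
  exact idealNil_le_of_injective (Subring.inclusion hle) (Subring.inclusion_injective hle)
    fun x hx => hx

lemma zclMap_comp_le_right (f : X ⟶ Y) (g : Y ⟶ Z) : zclMap k (f ≫ g) ≤ zclMap k g := by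
  refine idealNil_comap_range_le _ _ _ (singularPullback_squareMap_comp k f g) fun a ha => ?_
  -- The correction is made on `Z × Z`, for the whole composite; pulling `b` back along `g × g` then
  -- gives a zero-divisor that lies in the ring of `g`.
  obtain ⟨b, hb, hba⟩ := exists_mem_zeroDivisorIdeal_singularPullback_eq k (f ≫ g) ha
  exact ⟨b, singularPullback_squareMap_mem_zeroDivisorIdeal k g hb, hba⟩

end ZeroDivisors

theorem mainTheorem5 (k : Type v) [Field k] :
    IsCategoricalInvariant TopCat.{u} (fun X => zclSpace k X) (fun f => zclMap k f) ∧
      (∀ X : TopCat.{u}, zclMap k (𝟙 X) = zclSpace k X) ∧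
      (∀ {X Y Z : TopCat.{u}} (f : X ⟶ Y) (g : Y ⟶ Z),
        zclMap k (f ≫ g) ≤ min (zclMap k f) (zclMap k g)) :=
  -- Drop `f` by the lifting bound, then `h` by the subring bound.
  ⟨⟨zclMap_id k, fun f g h => (zclMap_comp_le_right k f (g ≫ h)).trans (zclMap_comp_le_left k g h)⟩,
    zclMap_id k, fun f g => le_min (zclMap_comp_le_left k f g) (zclMap_comp_le_right k f g)⟩
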